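/- For $n\ge 1$ let $O_n$ be the linear crossed octagonal graph: its $6n+2$ vertices are $1,2,\dots,3n+1$ and $1',2',\dots,(3n+1)'$, and its $13n+1$ edges are $\{k,k+1\}$, $\{k',(k+1)'\}$, $\{k,(k+1)'\}$, $\{k',k+1\}$ for $1\le k\le 3n$, together with the rungs $\{3s+1,(3s+1)'\}$ for $0\le s\le n$. (In other words, $O_n$ is the linear chain of $n$ octagons, with three pairs of crossed edges added in each octagon.) For a finite connected graph $G$ let $W(G)=\sum_{\{u,v\}} d(u,v)$ be its Wiener index and $Kf(G)=\sum_{\{u,v\}} r(u,v)$ its Kirchhoff index, where both sums run over all unordered pairs of distinct vertices, $d(u,v)$ is the length of a shortest path between $u$ and $v$, and $r(u,v)$ is the resistance distance, that is, the effective resistance between $u$ and $v$ when every edge of $G$ is a unit resistor. Theorem 1.2. For every $n\ge 1$, $$W(O_n)=18n^3+18n^2+9n+1,$$ and $$\lim_{n\to\infty}\frac{Kf(O_n)}{W(O_n)}=\frac14 .$$ -/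

import Mathlib

open Filter Topology

/-- The linear octagonal chain of `n` octagons. Its vertices are `(k, false)` and `(k, true)` for
`0 ≤ k ≤ 3 n`: two paths on `3 n + 1` vertices each, joined by a rung at every third position
`k = 0, 3, 6, …, 3 n`. Consecutive octagons share a rung. -/
def linearOctagonal (n : ℕ) : SimpleGraph (Fin (3 * n + 1) × Bool) where
  Adj x y :=
    (x.2 = y.2 ∧ (x.1.val + 1 = y.1.val ∨ y.1.val + 1 = x.1.val)) ∨
      (x.2 ≠ y.2 ∧ x.1 = y.1 ∧ 3 ∣ x.1.val)
  symm := ⟨by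
    rintro x y (⟨h, h'⟩ | ⟨h, h', h''⟩)
    · exact Or.inl ⟨h.symm, h'.symm⟩
    · exact Or.inr ⟨h.symm, h'.symm, h' ▸ h''⟩⟩
  loopless := ⟨by
    rintro x (⟨-, h | h⟩ | ⟨h, -⟩)
    · omega
    · omega
    · exact h rfl⟩

/-- The crossed edges: for every two consecutive positions `k`, `k + 1`, the pair of edges
joining `(k, false)` to `(k + 1, true)` and `(k, true)` to `(k + 1, false)`. There are three such
pairs in each octagon. -/
def crossedEdges (n : ℕ) : SimpleGraph (Fin (3 * n + 1) × Bool) where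
  Adj x y := x.2 ≠ y.2 ∧ (x.1.val + 1 = y.1.val ∨ y.1.val + 1 = x.1.val)
  symm := ⟨fun _ _ h => ⟨h.1.symm, h.2.symm⟩⟩
  loopless := ⟨fun _ h => h.1 rfl⟩

/-- The linear crossed octagonal graph `O_n`: the linear octagonal chain with the three pairs of
crossed edges added in each octagon. -/
def linearCrossedOctagonal (n : ℕ) : SimpleGraph (Fin (3 * n + 1) × Bool) :=
  linearOctagonal n ⊔ crossedEdges n

instance (n : ℕ) : DecidableRel (linearOctagonal n).Adj := fun x y =>
  inferInstanceAs (Decidable ((x.2 = y.2 ∧ (x.1.val + 1 = y.1.val ∨ y.1.val + 1 = x.1.val)) ∨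
      (x.2 ≠ y.2 ∧ x.1 = y.1 ∧ 3 ∣ x.1.val)))

instance (n : ℕ) : DecidableRel (crossedEdges n).Adj := fun x y =>
  inferInstanceAs (Decidable (x.2 ≠ y.2 ∧ (x.1.val + 1 = y.1.val ∨ y.1.val + 1 = x.1.val)))

instance (n : ℕ) : DecidableRel (linearCrossedOctagonal n).Adj := fun x y =>
  inferInstanceAs (Decidable ((linearOctagonal n).Adj x y ∨ (crossedEdges n).Adj x y))

section Indices

variable {V : Type*} [Fintype V] [DecidableEq V]

/-- `p` is an electrical potential on the network obtained from `G` by replacing every edge by a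
unit resistor, when a unit current enters at `u` and leaves at `v`. By Ohm's law the current along
the edge from `x` to `y` is `p x - p y`; by Kirchhoff's current law the total current flowing from
`x` into the network is the current supplied externally at `x`. -/
def IsUnitCurrentPotential (G : SimpleGraph V) [DecidableRel G.Adj] (u v : V) (p : V → ℝ) : Prop :=
  ∀ x, ∑ y ∈ G.neighborFinset x, (p x - p y) =
    (if x = u then 1 else 0) - (if x = v then 1 else 0)

open Classical in
/-- The resistance distance between `u` and `v` (for `G` connected): the potential difference
between `u` and `v` when a unit current enters at `u` and leaves at `v`, every edge being a unit
resistor. It does not depend on the potential, see `IsUnitCurrentPotential.resistanceDist_eq`.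
(The value is `0` by convention if `u` and `v` are in different components.) -/
noncomputable def resistanceDist (G : SimpleGraph V) [DecidableRel G.Adj] (u v : V) : ℝ :=
  if h : ∃ p, IsUnitCurrentPotential G u v p then h.choose u - h.choose v else 0

/-- The resistance distance is well defined: every potential gives the same difference. -/
theorem IsUnitCurrentPotential.resistanceDist_eq {G : SimpleGraph V} [DecidableRel G.Adj]
    {u v : V} {p : V → ℝ} (hp : IsUnitCurrentPotential G u v p) :
    resistanceDist G u v = p u - p v := by
  have h : ∃ p, IsUnitCurrentPotential G u v p := ⟨p, hp⟩
  have hq := h.choose_spec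
  rw [resistanceDist, dif_pos h]
  generalize h.choose = q at hq
  -- pair the equation for `q` with `p` and the one for `p` with `q`
  have key : ∀ f g : V → ℝ, ∑ x, g x * ∑ y ∈ G.neighborFinset x, (f x - f y) =
      ∑ x, f x * ∑ y ∈ G.neighborFinset x, (g x - g y) := by
    intro f g
    have e : ∀ f g : V → ℝ, ∑ x, g x * ∑ y ∈ G.neighborFinset x, (f x - f y) =
        (∑ x, ∑ y, if G.Adj x y then g x * f x else 0) -
          ∑ x, ∑ y, if G.Adj x y then g x * f y else 0 := by
      intro f g
      rw [← Finset.sum_sub_distrib]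
      refine Finset.sum_congr rfl fun x _ => ?_
      rw [SimpleGraph.neighborFinset_eq_filter, Finset.sum_filter, Finset.mul_sum,
        ← Finset.sum_sub_distrib]
      refine Finset.sum_congr rfl fun y _ => ?_
      split_ifs <;> ring
    rw [e f g, e g f]
    congr 1
    · simp only [mul_comm]
    · rw [Finset.sum_comm]
      simp only [G.adj_comm, mul_comm]
  have h1 := key p q
  simp only [hp _, hq _, mul_sub, Finset.sum_sub_distrib, mul_ite, mul_one, mul_zero,
    Finset.sum_ite_eq', Finset.mem_univ, if_true] at h1
  exact h1

/-- The Kirchhoff index: the sum of the resistance distances over all unordered pairs of distinct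
vertices, written as half of the sum over ordered pairs. -/
noncomputable def kirchhoffIndex (G : SimpleGraph V) [DecidableRel G.Adj] : ℝ :=
  (∑ u, ∑ v, resistanceDist G u v) / 2

/-- The Wiener index: the sum of the distances over all unordered pairs of distinct vertices,
written as half of the sum over ordered pairs. -/
noncomputable def wienerIndex (G : SimpleGraph V) : ℝ :=
  (∑ u, ∑ v, (G.dist u v : ℝ)) / 2

end Indices

/-! Any two vertices at consecutive positions are adjacent, and rungs do not change the position. So
vertices at distinct positions are as far apart as their positions, and two vertices at one position
are at distance 1 or 2 (`dist_eq`); summing gives `W`. Swapping the two vertices of a position is a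
symmetry, so potentials split into two parts. On symmetric functions the network is a path whose
consecutive positions are joined by four parallel resistors, of resistance 1/4; on antisymmetric
functions the Laplacian is diagonal with eigenvalues at least 2. This yields explicit potentials,
and resistance differs from a quarter of the distance by a bounded amount
(`abs_resistanceDist_sub_dist_le`). There are quadratically many pairs while `W` is cubic, so the
error vanishes in the ratio. -/

theorem linearCrossedOctagonal_adj {n : ℕ} {x y : Fin (3 * n + 1) × Bool} :
    (linearCrossedOctagonal n).Adj x y ↔
      (x.1.val + 1 = y.1.val ∨ y.1.val + 1 = x.1.val) ∨
        (x.2 ≠ y.2 ∧ x.1.val = y.1.val ∧ 3 ∣ x.1.val) := by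
  rw [← Fin.ext_iff]
  change (((_ ∧ _) ∨ _) ∨ (_ ∧ _)) ↔ _
  tauto

namespace LinearCrossedOctagonal

/-! ### Distances -/

theorem exists_walk_of_add_eq {n : ℕ} (d : ℕ) (x y : Fin (3 * n + 1) × Bool)
    (h : x.1.val + (d + 1) = y.1.val) :
    ∃ w : (linearCrossedOctagonal n).Walk x y, w.length = d + 1 := by
  induction d generalizing x with
  | zero => exact ⟨(linearCrossedOctagonal_adj.2 (Or.inl (Or.inl h))).toWalk, rfl⟩
  | succ d ih =>
    have hlt : x.1.val + 1 < 3 * n + 1 := by have := y.1.isLt; omega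
    obtain ⟨w, hw⟩ := ih (⟨x.1.val + 1, hlt⟩, x.2) (by simp only; omega)
    have hadj : (linearCrossedOctagonal n).Adj x (⟨x.1.val + 1, hlt⟩, x.2) :=
      linearCrossedOctagonal_adj.2 (Or.inl (Or.inl rfl))
    exact ⟨.cons hadj w, by simp [hw]⟩

theorem position_le_add_walk_length {n : ℕ} {x y : Fin (3 * n + 1) × Bool}
    (w : (linearCrossedOctagonal n).Walk x y) : y.1.val ≤ x.1.val + w.length := by
  induction w with
  | nil => simp
  | cons h w ih =>
    rw [linearCrossedOctagonal_adj] at h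
    rw [SimpleGraph.Walk.length_cons]
    omega

theorem dist_of_lt {n : ℕ} {x y : Fin (3 * n + 1) × Bool} (h : x.1.val < y.1.val) :
    (linearCrossedOctagonal n).dist x y = y.1.val - x.1.val := by
  obtain ⟨w, hw⟩ := exists_walk_of_add_eq (y.1.val - x.1.val - 1) x y (by omega)
  obtain ⟨w', hw'⟩ := w.reachable.exists_walk_length_eq_dist
  have h1 := SimpleGraph.dist_le w
  have h2 := position_le_add_walk_length w'
  omega

theorem dist_same_position {n : ℕ} {x y : Fin (3 * n + 1) × Bool} (h : x.1 = y.1)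
    (h' : x.2 ≠ y.2) :
    (linearCrossedOctagonal n).dist x y = if 3 ∣ x.1.val then 1 else 2 := by
  have hval : x.1.val = y.1.val := congrArg Fin.val h
  split_ifs with hd
  · exact SimpleGraph.dist_eq_one_iff_adj.2
      (linearCrossedOctagonal_adj.2 (Or.inr ⟨h', hval, hd⟩))
  -- Without a rung the position is not 0, so the path of length 2 can pass through the preceding
  -- position.
  · have hpos : 0 < x.1.val := Nat.pos_of_ne_zero fun h0 => hd (h0 ▸ dvd_zero 3)
    have hlt : x.1.val - 1 < 3 * n + 1 := by have := x.1.isLt; omega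
    have h1 : (linearCrossedOctagonal n).Adj x (⟨x.1.val - 1, hlt⟩, x.2) :=
      linearCrossedOctagonal_adj.2 (Or.inl (Or.inr (by simp only; omega)))
    have h2 : (linearCrossedOctagonal n).Adj (⟨x.1.val - 1, hlt⟩, x.2) y :=
      linearCrossedOctagonal_adj.2 (Or.inl (Or.inl (by simp only; omega)))
    have hle := SimpleGraph.dist_le (SimpleGraph.Walk.cons h1 h2.toWalk)
    have hne1 : (linearCrossedOctagonal n).dist x y ≠ 1 := by
      rw [Ne, SimpleGraph.dist_eq_one_iff_adj, linearCrossedOctagonal_adj]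
      rintro ((h | h) | ⟨-, -, h⟩)
      · omega
      · omega
      · exact hd h
    have hpos' := (h1.reachable.trans h2.reachable).pos_dist_of_ne (fun e => h' (congrArg _ e))
    simp at hle
    omega

theorem dist_eq {n : ℕ} (x y : Fin (3 * n + 1) × Bool) :
    ((linearCrossedOctagonal n).dist x y : ℝ) =
      |(x.1.val : ℝ) - y.1.val| +
        if x.1 = y.1 then (if x.2 = y.2 then 0 else if 3 ∣ x.1.val then 1 else 2) else 0 := by
  rcases lt_trichotomy x.1.val y.1.val with h | h | h
  · have hne : x.1 ≠ y.1 := fun e => h.ne (congrArg _ e)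
    rw [dist_of_lt h, if_neg hne, Nat.cast_sub h.le, abs_sub_comm, abs_of_nonneg, add_zero]
    exact sub_nonneg.2 (Nat.cast_le.2 h.le)
  · have he : x.1 = y.1 := Fin.ext h
    rw [if_pos he, h, sub_self, abs_zero, zero_add]
    split_ifs with h2 h3
    · rw [Prod.ext he h2, SimpleGraph.dist_self, Nat.cast_zero]
    · rw [dist_same_position he h2, if_pos (h ▸ h3), Nat.cast_one]
    · rw [dist_same_position he h2, if_neg (h ▸ h3), Nat.cast_ofNat]
  · have hne : x.1 ≠ y.1 := fun e => h.ne' (congrArg _ e)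
    rw [SimpleGraph.dist_comm, dist_of_lt h, if_neg hne, Nat.cast_sub h.le, abs_of_nonneg,
      add_zero]
    exact sub_nonneg.2 (Nat.cast_le.2 h.le)

/-! ### The Wiener index -/

theorem sum_range_sub_cast (N : ℕ) :
    ∑ i ∈ Finset.range N, ((N : ℝ) - i) = ((N : ℝ) ^ 2 + N) / 2 := by
  induction N with
  | zero => simp
  | succ N ih =>
    have : ∀ i ∈ Finset.range N, (((N + 1 : ℕ) : ℝ) - i) = ((N : ℝ) - i) + 1 := fun i _ => by
      push_cast; ring
    rw [Finset.sum_range_succ, Finset.sum_congr rfl this, Finset.sum_add_distrib, ih]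
    simp
    ring

theorem sum_range_abs_sub (N : ℕ) :
    ∑ i ∈ Finset.range N, ∑ j ∈ Finset.range N, |(i : ℝ) - j| = ((N : ℝ) ^ 3 - N) / 3 := by
  induction N with
  | zero => simp
  | succ N ih =>
    have h1 : ∑ i ∈ Finset.range N, |(i : ℝ) - N| = ((N : ℝ) ^ 2 + N) / 2 := by
      rw [← sum_range_sub_cast]
      refine Finset.sum_congr rfl fun i hi => ?_
      rw [abs_sub_comm, abs_of_nonneg]
      exact sub_nonneg.2 (Nat.cast_le.2 (Finset.mem_range.1 hi).le)
    have h2 : ∑ i ∈ Finset.range N, |(N : ℝ) - i| = ((N : ℝ) ^ 2 + N) / 2 := by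
      simp only [abs_sub_comm (N : ℝ), h1]
    simp only [Finset.sum_range_succ, Finset.sum_add_distrib, ih, h1, h2, sub_self, abs_zero]
    push_cast
    ring

theorem sum_range_rung_dist (n : ℕ) :
    ∑ k ∈ Finset.range (3 * n + 1), (if 3 ∣ k then 1 else 2 : ℝ) = 5 * n + 1 := by
  induction n with
  | zero => simp
  | succ n ih =>
    have h1 : ¬ 3 ∣ 3 * n + 1 := by omega
    have h2 : ¬ 3 ∣ 3 * n + 1 + 1 := by omega
    have h3 : 3 ∣ 3 * n + 1 + 1 + 1 := by omega
    rw [show 3 * (n + 1) + 1 = 3 * n + 1 + 1 + 1 + 1 by ring, Finset.sum_range_succ,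
      Finset.sum_range_succ, Finset.sum_range_succ, ih, if_neg h1, if_neg h2, if_pos h3]
    push_cast
    ring

theorem wienerIndex_eq (n : ℕ) :
    wienerIndex (linearCrossedOctagonal n) = 18 * (n : ℝ) ^ 3 + 18 * (n : ℝ) ^ 2 + 9 * n + 1 := by
  have h1 : ∑ i : Fin (3 * n + 1), ∑ j : Fin (3 * n + 1), |((i : ℕ) : ℝ) - (j : ℕ)| =
      (((3 * n + 1 : ℕ) : ℝ) ^ 3 - (3 * n + 1 : ℕ)) / 3 := by
    rw [← sum_range_abs_sub, ← Fin.sum_univ_eq_sum_range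
      (fun i => ∑ j ∈ Finset.range (3 * n + 1), |((i : ℕ) : ℝ) - (j : ℕ)|)]
    refine Finset.sum_congr rfl fun i _ => ?_
    rw [← Fin.sum_univ_eq_sum_range (fun j => |((i : ℕ) : ℝ) - (j : ℕ)|)]
  have h2 := sum_range_rung_dist n
  rw [← Fin.sum_univ_eq_sum_range (fun k => (if 3 ∣ k then 1 else 2 : ℝ))] at h2
  -- Over ordered pairs, each position difference occurs four times (the choices of flags) and each
  -- same-position term twice.
  simp only [wienerIndex, dist_eq, Finset.sum_add_distrib, Fintype.sum_prod_type,
    Fintype.sum_bool, Finset.sum_ite_eq, Finset.mem_univ, if_true, reduceCtorEq, if_false, h1,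
    h2, Finset.sum_const_zero]
  push_cast
  ring

/-! ### Resistance distances -/

theorem sum_neighborFinset {n : ℕ} (x : Fin (3 * n + 1) × Bool) (g : ℕ → Bool → ℝ) :
    ∑ y ∈ (linearCrossedOctagonal n).neighborFinset x, g y.1.val y.2 =
      (if x.1.val < 3 * n then g (x.1.val + 1) true + g (x.1.val + 1) false else 0) +
      (if 0 < x.1.val then g (x.1.val - 1) true + g (x.1.val - 1) false else 0) +
      (if 3 ∣ x.1.val then g x.1.val (!x.2) else 0) := by
  obtain ⟨⟨k, hk⟩, b⟩ := x
  have split : ∀ y : Fin (3 * n + 1) × Bool,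
      (if (linearCrossedOctagonal n).Adj (⟨k, hk⟩, b) y then g y.1.val y.2 else 0) =
        (if k + 1 = y.1.val then g y.1.val y.2 else 0) +
        -- At `k = 0` the subtraction truncates and the inner guard removes the spurious term.
        (if y.1.val = k - 1 then (if 0 < k then g y.1.val y.2 else 0) else 0) +
        (if k = y.1.val then (if b ≠ y.2 then (if 3 ∣ k then g y.1.val y.2 else 0) else 0)
          else 0) := by
    intro y
    simp only [linearCrossedOctagonal_adj]
    generalize g y.1.val y.2 = t
    generalize y.1.val = j
    by_cases hb : b = y.2
    · simp only [hb, ne_eq, not_true, false_and, or_false, if_false, ite_self, add_zero]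
      split_ifs <;> first | omega | simp
    · simp only [hb, ne_eq, not_false_eq_true, true_and, if_true]
      split_ifs <;> first | omega | simp
  have lt_iff : k + 1 < 3 * n + 1 ↔ k < 3 * n := by omega
  have hk' : k - 1 < 3 * n + 1 := by omega
  rw [SimpleGraph.neighborFinset_eq_filter, Finset.sum_filter]
  simp only [split, Finset.sum_add_distrib, Fintype.sum_prod_type_right, Fintype.sum_bool]
  have e1 : ∀ c, ∑ j : Fin (3 * n + 1), (if k + 1 = j.val then g j.val c else 0) =
      if k < 3 * n then g (k + 1) c else 0 := fun c => by
    rw [Fin.sum_univ_eq_sum_range (fun j => if k + 1 = j then g j c else 0), Finset.sum_ite_eq]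
    simp only [Finset.mem_range, lt_iff]
  have e2 : ∀ c, ∑ j : Fin (3 * n + 1),
      (if j.val = k - 1 then (if 0 < k then g j.val c else 0) else 0) =
      if 0 < k then g (k - 1) c else 0 := fun c => by
    rw [Fin.sum_univ_eq_sum_range
      (fun j => if j = k - 1 then (if 0 < k then g j c else 0) else 0), Finset.sum_ite_eq',
      if_pos (Finset.mem_range.2 hk')]
  have e3 : ∀ c, ∑ j : Fin (3 * n + 1),
      (if k = j.val then (if b ≠ c then (if 3 ∣ k then g j.val c else 0) else 0) else 0) =
      if b ≠ c then (if 3 ∣ k then g k c else 0) else 0 := fun c => by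
    rw [Fin.sum_univ_eq_sum_range
      (fun j => if k = j then (if b ≠ c then (if 3 ∣ k then g j c else 0) else 0) else 0),
      Finset.sum_ite_eq, if_pos (Finset.mem_range.2 hk)]
  simp only [e1, e2, e3]
  cases b <;>
    simp only [ne_eq, reduceCtorEq, not_false_eq_true, not_true, if_true, if_false,
      Bool.not_true, Bool.not_false] <;>
    split_ifs <;> ring

/-- The degree of a vertex at position `k`, the rung counted twice: the eigenvalue of the
Laplacian on the function that is `1` and `-1` on the two vertices at position `k` and vanishes
elsewhere. -/
def antisymmEigenvalue (n k : ℕ) : ℝ :=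
  (if k < 3 * n then 2 else 0) + (if 0 < k then 2 else 0) + (if 3 ∣ k then 2 else 0)

/-- Every position other than 0 has a preceding one, and position 0 carries a rung. -/
theorem two_le_antisymmEigenvalue (n k : ℕ) : 2 ≤ antisymmEigenvalue n k := by
  have : ¬ 0 < k → 3 ∣ k := fun h => by omega
  unfold antisymmEigenvalue
  split_ifs <;> first | omega | norm_num

/-- The antisymmetric part of the potential created by a unit current entering at `(i, a)`. -/
noncomputable def antisymmPotential (n i : ℕ) (a : Bool) (k : ℕ) (b : Bool) : ℝ :=
  if k = i then (if b = a then 1 else -1) / (2 * antisymmEigenvalue n i) else 0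

/-- A potential created by a unit current entering at `(i, a)` and leaving evenly through the four
vertices of the two end positions. -/
noncomputable def sourcePotential (n i : ℕ) (a : Bool) (k : ℕ) (b : Bool) : ℝ :=
  -|(k : ℝ) - i| / 8 + antisymmPotential n i a k b

theorem abs_antisymmPotential_le (n i : ℕ) (a : Bool) (k : ℕ) (b : Bool) :
    |antisymmPotential n i a k b| ≤ 1 / 4 := by
  have h := two_le_antisymmEigenvalue n i
  have h' : 1 / (2 * antisymmEigenvalue n i) ≤ 1 / 4 :=
    one_div_le_one_div_of_le (by norm_num) (by linarith)
  have h0 : 0 ≤ 1 / (2 * antisymmEigenvalue n i) := by positivity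
  unfold antisymmPotential
  split_ifs
  · rwa [abs_of_nonneg h0]
  · rwa [neg_div, abs_neg, abs_of_nonneg h0]
  · norm_num

theorem abs_cast_succ_sub (k i : ℕ) :
    |((k + 1 : ℕ) : ℝ) - i| = |(k : ℝ) - i| + if i ≤ k then 1 else -1 := by
  split_ifs with h
  · have : (i : ℝ) ≤ k := Nat.cast_le.2 h
    push_cast
    rw [abs_of_nonneg (by linarith), abs_of_nonneg (by linarith)]
    ring
  · have : (k : ℝ) + 1 ≤ i := by exact_mod_cast Nat.lt_of_not_le h
    push_cast
    rw [abs_of_nonpos (by linarith), abs_of_nonpos (by linarith)]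
    ring

theorem laplacian_antisymmPotential {n : ℕ} (u x : Fin (3 * n + 1) × Bool) :
    ∑ y ∈ (linearCrossedOctagonal n).neighborFinset x,
        (antisymmPotential n u.1 u.2 x.1 x.2 - antisymmPotential n u.1 u.2 y.1 y.2) =
      if x.1.val = u.1.val then (if x.2 = u.2 then 1 / 2 else -1 / 2) else 0 := by
  rw [sum_neighborFinset x (fun k b => antisymmPotential n u.1 u.2 x.1 x.2 -
    antisymmPotential n u.1 u.2 k b)]
  obtain ⟨⟨k, hk⟩, b⟩ := x
  obtain ⟨⟨i, hi⟩, a⟩ := u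
  have pair : ∀ j, antisymmPotential n i a j true + antisymmPotential n i a j false = 0 := by
    intro j
    unfold antisymmPotential
    cases a <;> split_ifs <;> first | simp_all; done | (simp; try ring)
  have opp : antisymmPotential n i a k (!b) = -antisymmPotential n i a k b := by
    have := pair k
    cases b <;> simp <;> linarith
  -- The potential cancels over the two vertices of a neighbouring position, so only the value at
  -- `x` survives: this is why the Laplacian acts diagonally.
  have e : ∀ p j, p - antisymmPotential n i a j true + (p - antisymmPotential n i a j false) =
      2 * p := fun p j => by linarith [pair j]
  simp only [e, opp]
  have hD : (if k < 3 * n then 2 * antisymmPotential n i a k b else 0) +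
      (if 0 < k then 2 * antisymmPotential n i a k b else 0) +
      (if 3 ∣ k then antisymmPotential n i a k b - -antisymmPotential n i a k b else 0) =
      antisymmEigenvalue n k * antisymmPotential n i a k b := by
    unfold antisymmEigenvalue
    split_ifs <;> ring
  rw [hD]
  have h0 : antisymmEigenvalue n i ≠ 0 := by linarith [two_le_antisymmEigenvalue n i]
  unfold antisymmPotential
  split_ifs with h1 h2
  · subst h1; field_simp
  · subst h1; field_simp
  · ring

/-- The slope 1/8 sends 1/8 along each of four edges, hence current 1/2 from the source position
towards each end, where it leaves as 1/4 per vertex. -/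
theorem laplacian_sourcePotential {n : ℕ} (u x : Fin (3 * n + 1) × Bool) :
    ∑ y ∈ (linearCrossedOctagonal n).neighborFinset x,
        (sourcePotential n u.1 u.2 x.1 x.2 - sourcePotential n u.1 u.2 y.1 y.2) =
      (if x = u then 1 else 0) - ((if x.1.val = 0 then 1 / 4 else 0) +
        (if x.1.val = 3 * n then 1 / 4 else 0)) := by
  have hsplit : ∀ y : Fin (3 * n + 1) × Bool,
      sourcePotential n u.1 u.2 x.1 x.2 - sourcePotential n u.1 u.2 y.1 y.2 =
      (-|(x.1.val : ℝ) - u.1.val| / 8 - -|(y.1.val : ℝ) - u.1.val| / 8) +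
      (antisymmPotential n u.1 u.2 x.1 x.2 - antisymmPotential n u.1 u.2 y.1 y.2) := fun y => by
    unfold sourcePotential; ring
  simp only [hsplit, Finset.sum_add_distrib, laplacian_antisymmPotential]
  rw [sum_neighborFinset x
    (fun k _ => -|(x.1.val : ℝ) - u.1.val| / 8 - -|(k : ℝ) - u.1.val| / 8)]
  obtain ⟨⟨k, hk⟩, b⟩ := x
  obtain ⟨⟨i, hi⟩, a⟩ := u
  simp only [Prod.mk.injEq, Fin.mk.injEq, sub_self, ite_self, add_zero]
  rw [abs_cast_succ_sub]
  -- The kink of the absolute value injects 1/2 at both vertices of position `i`; the antisymmetric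
  -- part adds 1/2 at the source and removes it at its twin.
  have hsymm : (if k < 3 * n then
        -|(k : ℝ) - i| / 8 - -(|(k : ℝ) - i| + if i ≤ k then 1 else -1) / 8 + (-|(k : ℝ) - i| / 8 - -(|(k : ℝ) - i| + if i ≤ k then 1 else -1) / 8) else 0) +
      (if 0 < k then -|(k : ℝ) - i| / 8 - -|((k - 1 : ℕ) : ℝ) - i| / 8 +
        (-|(k : ℝ) - i| / 8 - -|((k - 1 : ℕ) : ℝ) - i| / 8) else 0) =
      (if k = i then 1 / 2 else 0) - ((if k = 0 then 1 / 4 else 0) +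
        (if k = 3 * n then 1 / 4 else 0)) := by
    rcases k with - | k
    · split_ifs <;> first | contradiction | omega | ring
    · rw [Nat.add_sub_cancel, abs_cast_succ_sub]
      split_ifs <;> first | contradiction | omega | ring
  rw [hsymm]
  by_cases h1 : k = i <;> by_cases h2 : b = a <;> simp [h1, h2] <;> ring

/-- The outflow at the ends does not depend on the source, so it cancels in the difference. -/
theorem isUnitCurrentPotential_sub {n : ℕ} (u v : Fin (3 * n + 1) × Bool) :
    IsUnitCurrentPotential (linearCrossedOctagonal n) u v
      (fun x => sourcePotential n u.1 u.2 x.1 x.2 - sourcePotential n v.1 v.2 x.1 x.2) := by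
  intro x
  have hu := laplacian_sourcePotential u x
  have hv := laplacian_sourcePotential v x
  simp only [sub_sub_sub_comm _ (sourcePotential n v.1 v.2 x.1 x.2)]
  rw [Finset.sum_sub_distrib, hu, hv]
  ring

/-! ### Comparison of resistance with distance, and the limit -/

theorem abs_resistanceDist_sub_dist_le {n : ℕ} (u v : Fin (3 * n + 1) × Bool) :
    |resistanceDist (linearCrossedOctagonal n) u v -
      ((linearCrossedOctagonal n).dist u v : ℝ) / 4| ≤ 2 := by
  rw [(isUnitCurrentPotential_sub u v).resistanceDist_eq, dist_eq]
  have h1 := abs_le.1 (abs_antisymmPotential_le n u.1 u.2 u.1 u.2)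
  have h2 := abs_le.1 (abs_antisymmPotential_le n u.1 u.2 v.1 v.2)
  have h3 := abs_le.1 (abs_antisymmPotential_le n v.1 v.2 u.1 u.2)
  have h4 := abs_le.1 (abs_antisymmPotential_le n v.1 v.2 v.1 v.2)
  have h5 : 0 ≤ (if u.1 = v.1 then (if u.2 = v.2 then 0 else if 3 ∣ u.1.val then 1 else 2)
      else 0 : ℝ) ∧ (if u.1 = v.1 then (if u.2 = v.2 then 0 else if 3 ∣ u.1.val then 1 else 2)
      else 0 : ℝ) ≤ 2 := by
    split_ifs <;> norm_num
  simp only [sourcePotential, sub_self, abs_zero, abs_sub_comm (v.1.val : ℝ) u.1.val]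
  rw [abs_le]
  -- Four antisymmetric terms contribute at most 1/4 each, and the same-position correction at most
  -- 2/4.
  constructor <;> linarith [h5.1, h5.2, h1.1, h1.2, h2.1, h2.2, h3.1, h3.2, h4.1, h4.2]

theorem abs_kirchhoffIndex_sub_wienerIndex_le (n : ℕ) :
    |kirchhoffIndex (linearCrossedOctagonal n) - wienerIndex (linearCrossedOctagonal n) / 4| ≤
      (6 * n + 2) ^ 2 := by
  have h : kirchhoffIndex (linearCrossedOctagonal n) -
      wienerIndex (linearCrossedOctagonal n) / 4 =
      (∑ u, ∑ v, (resistanceDist (linearCrossedOctagonal n) u v -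
        ((linearCrossedOctagonal n).dist u v : ℝ) / 4)) / 2 := by
    simp only [kirchhoffIndex, wienerIndex, Finset.sum_sub_distrib, ← Finset.sum_div]
    ring
  have hsum : |∑ u, ∑ v, (resistanceDist (linearCrossedOctagonal n) u v -
        ((linearCrossedOctagonal n).dist u v : ℝ) / 4)| ≤
      ∑ _u : Fin (3 * n + 1) × Bool, ∑ _v : Fin (3 * n + 1) × Bool, (2 : ℝ) :=
    (Finset.abs_sum_le_sum_abs _ _).trans <| Finset.sum_le_sum fun u _ =>
      (Finset.abs_sum_le_sum_abs _ _).trans <| Finset.sum_le_sum fun v _ =>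
        abs_resistanceDist_sub_dist_le u v
  simp only [Finset.sum_const, Finset.card_univ, Fintype.card_prod, Fintype.card_fin,
    Fintype.card_bool, nsmul_eq_mul] at hsum
  push_cast at hsum
  rw [h, abs_div, abs_two, div_le_iff₀ two_pos]
  linarith

theorem tendsto_kirchhoffIndex_div_wienerIndex :
    Tendsto
      (fun n : ℕ =>
        kirchhoffIndex (linearCrossedOctagonal n) / wienerIndex (linearCrossedOctagonal n))
      atTop (𝓝 (1 / 4)) := by
  rw [tendsto_iff_dist_tendsto_zero]
  -- The error is at most `(6n+2)^2` and `W` exceeds `18n^3`, so `4/n` bounds the quotient with room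
  -- to spare.
  refine squeeze_zero' (Eventually.of_forall fun _ => dist_nonneg) ?_
    (tendsto_const_div_atTop_nhds_zero_nat 4)
  filter_upwards [eventually_ge_atTop 1] with n hn
  have hn' : (1 : ℝ) ≤ n := by exact_mod_cast hn
  have hW := wienerIndex_eq n
  have hWpos : 0 < wienerIndex (linearCrossedOctagonal n) := by rw [hW]; positivity
  have hsub : kirchhoffIndex (linearCrossedOctagonal n) /
      wienerIndex (linearCrossedOctagonal n) - 1 / 4 =
      (kirchhoffIndex (linearCrossedOctagonal n) -
        wienerIndex (linearCrossedOctagonal n) / 4) /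
      wienerIndex (linearCrossedOctagonal n) := by
    field_simp
  rw [Real.dist_eq, hsub, abs_div, abs_of_pos hWpos, div_le_div_iff₀ hWpos (by positivity)]
  calc _ ≤ (6 * (n : ℝ) + 2) ^ 2 * n :=
        mul_le_mul_of_nonneg_right (abs_kirchhoffIndex_sub_wienerIndex_le n) (by positivity)
    _ ≤ _ := by
        rw [hW]
        have h3 : 0 ≤ (n : ℝ) ^ 3 := by positivity
        have h2 : 0 ≤ (n : ℝ) ^ 2 := by positivity
        nlinarith

end LinearCrossedOctagonal

theorem theorem1p2 :
    (∀ n : ℕ, 1 ≤ n →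
      wienerIndex (linearCrossedOctagonal n) = 18 * (n : ℝ) ^ 3 + 18 * (n : ℝ) ^ 2 + 9 * n + 1) ∧
    Tendsto
      (fun n : ℕ =>
        kirchhoffIndex (linearCrossedOctagonal n) / wienerIndex (linearCrossedOctagonal n))
      atTop (𝓝 (1 / 4)) :=
  ⟨fun n _ => LinearCrossedOctagonal.wienerIndex_eq n,
    LinearCrossedOctagonal.tendsto_kirchhoffIndex_div_wienerIndex⟩
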